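/- Let $n$ be a positive odd integer. For $s\in\mathbb Z/n\mathbb Z$ let $Z(s)=\{2^js : j\ge 0\}$ be its $2$-cyclotomic coset, and for an integer $b$ with $\gcd(n,b)=1$ let $\mu_b(x)=bx$ on $\mathbb Z/n\mathbb Z$. A $3$-splitting of $\mathbb Z/n\mathbb Z$ is a tuple $(X_\infty,X_0,X_1,X_2)$ of pairwise disjoint unions of $2$-cyclotomic cosets with union $\mathbb Z/n\mathbb Z$ (empty sets are allowed) such that for some $b$ with $\gcd(n,b)=1$ we have $\mu_b(X_0)=X_1$, $\mu_b(X_1)=X_2$, $\mu_b(X_2)=X_0$, and $\mu_b(Z(s))=Z(s)$ for every $s\in X_\infty$. Fix a primitive $n$-th root of unity $\alpha$ in an extension field of $\mathbb F_2$. The defining set of a binary cyclic code of length $n$ with generator polynomial $g$ is $\{t\in\mathbb Z/n\mathbb Z : g(\alpha^t)=0\}$. A pair of odd-like and even-like triadic codes belonging to the $3$-splitting is a pair of binary cyclic codes $C_1,C_2$ of length $n$ with defining sets $X_i$ and $X_\infty\cup X_i\cup X_j$, respectively, for some $i\neq j$ in $\{0,1,2\}$. **Theorem.** Let $(X_\infty,X_0,X_1,X_2)$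 be a $3$-splitting of $\mathbb Z/n\mathbb Z$. Then $3$ divides $n+2|X_\infty|$, a pair of odd-like and even-like triadic codes belonging to the splitting exists, and for every such pair $C_1,C_2$ we have $C_2\subseteq C_1$ and the following holds. Let $$d=d(C_1\setminus C_2)=\min\{\mathrm{wt}(c): c\in C_1\setminus C_2\},$$ where $\mathrm{wt}$ is the Hamming weight (the set $C_1\setminus C_2$ is nonempty). Then the CSS code of $C_2\subseteq C_1$, that is, the common $+1$-eigenspace in $(\mathbb C^2)^{\otimes n}$ of the Pauli operators $X^u$ $(u\in C_2)$ and $Z^v$ $(v\in C_1^{\perp})$, is a binary quantum code with parameters $$\Bigl[\!\Bigl[n,\ \tfrac{n+2|X_\infty|}{3},\ d\Bigr]\!\Bigr]_2 .$$ Here an $[\![n,k,d]\!]_2$ binary quantum code with $k\ge 1$ is a $2^k$-dimensional subspace $Q$ of $(\mathbb C^2)^{\otimes n}$ whose minimum distance is exactly $d$, i.e. $d$ is the least weight (number of nonidentity tensor factors) of a Pauli operator $E=X^uZ^v$ not detectable by $Q$; $E$ is detectable if there is a constant $c\in\mathbb C$ with $\langle x,Ey\rangle=c\langle x,y\rangle$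 for all $x,y\in Q$. -/

import Mathlib

open scoped Matrix Polynomial

namespace TriadicCode

/-! ## Splittings of `ℤ/nℤ` -/

section Splittings

/-- The `2`-cyclotomic coset `Z(s)` modulo `n`. -/
def cyclotomicCoset {n : ℕ} (s : ZMod n) : Set (ZMod n) :=
  Set.range fun j : ℕ => s * 2 ^ j

/-- `A` is a union of `2`-cyclotomic cosets. -/
def IsUnionOfCosets {n : ℕ} (A : Set (ZMod n)) : Prop :=
  ∃ T : Set (ZMod n), A = ⋃ s ∈ T, cyclotomicCoset s

/-- The map `μ_b : x ↦ b x` on `ℤ/nℤ`; it is called a multiplier when `gcd(n, b) = 1`. -/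
def mulMap (n : ℕ) (b : ℤ) (x : ZMod n) : ZMod n := (b : ZMod n) * x

/-- `(Xinf, X 0, X 1, X 2)` is a `3`-splitting of `ℤ/nℤ`; the indices of `X` are taken
modulo `3`. -/
structure IsThreeSplitting (n : ℕ) (Xinf : Set (ZMod n)) (X : Fin 3 → Set (ZMod n)) : Prop where
  coset_inf : IsUnionOfCosets Xinf
  coset : ∀ i, IsUnionOfCosets (X i)
  cover : Xinf ∪ X 0 ∪ X 1 ∪ X 2 = Set.univ
  disjoint_inf : ∀ i, Disjoint Xinf (X i)
  disjoint : ∀ i j, i ≠ j → Disjoint (X i) (X j)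
  multiplier : ∃ b : ℤ, Int.gcd (n : ℤ) b = 1 ∧
    (∀ i, mulMap n b '' X i = X (i + 1)) ∧
    ∀ s ∈ Xinf, mulMap n b '' cyclotomicCoset s = cyclotomicCoset s

end Splittings

/-! ## Binary linear and cyclic codes -/

section Codes

/-- A binary linear code of length `n`. -/
abbrev BinaryCode (n : ℕ) := Submodule (ZMod 2) (Fin n → ZMod 2)

/-- The Euclidean dual code. -/
def dual {n : ℕ} (C : BinaryCode n) : BinaryCode n where
  carrier := {u | ∀ c ∈ C, u ⬝ᵥ c = 0}
  add_mem' := by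
    intro a b ha hb c hc
    rw [add_dotProduct, ha c hc, hb c hc, add_zero]
  zero_mem' := by
    intro c _
    exact zero_dotProduct c
  smul_mem' := by
    intro r a ha c hc
    rw [smul_dotProduct, ha c hc, smul_zero]

/-- `C` is invariant under `(c_0, …, c_{n-1}) ↦ (c_{n-1}, c_0, …, c_{n-2})`. -/
def IsCyclic {n : ℕ} (C : BinaryCode n) : Prop :=
  ∀ c ∈ C, c ∘ (finRotate n).symm ∈ C

/-- The polynomial `c(x) = ∑ c_i x^i` of a vector. -/
noncomputable def toPoly {n : ℕ} (c : Fin n → ZMod 2) : (ZMod 2)[X] :=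
  ∑ i, Polynomial.C (c i) * Polynomial.X ^ (i : ℕ)

/-- `g` is the generator polynomial of `C`: the monic divisor of `x^n - 1` whose multiples
modulo `x^n - 1` are exactly the codewords. -/
def IsGeneratorPolynomial {n : ℕ} (C : BinaryCode n) (g : (ZMod 2)[X]) : Prop :=
  g.Monic ∧ g ∣ Polynomial.X ^ n - 1 ∧ ∀ c, c ∈ C ↔ g ∣ toPoly c

/-- `C` is a cyclic code with defining set `A`, relative to the primitive root of unity `α`. -/
def HasDefiningSet {n : ℕ} {F : Type*} [Field F] [Algebra (ZMod 2) F] (α : F)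
    (C : BinaryCode n) (A : Set (ZMod n)) : Prop :=
  IsCyclic C ∧ ∃ g, IsGeneratorPolynomial C g ∧ A = {t | Polynomial.aeval (α ^ t.val) g = 0}

/-- `C₁` and `C₂` are a pair of odd-like and even-like triadic codes belonging to
`(Xinf, X 0, X 1, X 2)`. -/
def IsTriadicPair {n : ℕ} {F : Type*} [Field F] [Algebra (ZMod 2) F] (α : F)
    (Xinf : Set (ZMod n)) (X : Fin 3 → Set (ZMod n)) (C₁ C₂ : BinaryCode n) : Prop :=
  ∃ i j, i ≠ j ∧ HasDefiningSet α C₁ (X i) ∧ HasDefiningSet α C₂ (Xinf ∪ X i ∪ X j)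

/-- `d` is the minimum Hamming weight `d(C₁ \ C₂)` of a vector in `C₁ \ C₂`. -/
def IsRelativeDistance {n : ℕ} (C₁ C₂ : BinaryCode n) (d : ℕ) : Prop :=
  IsLeast {w | ∃ c, c ∈ C₁ ∧ c ∉ C₂ ∧ hammingNorm c = w} d

end Codes

/-! ## Binary quantum codes -/

section Quantum

/-- The state space `(ℂ²)^{⊗ n}`, in coordinates with respect to the computational basis, which
is indexed by bit strings. The inner product of `x` and `y` is `star x ⬝ᵥ y`. -/
abbrev QubitSpace (n : ℕ) := (Fin n → ZMod 2) → ℂ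

/-- The Pauli matrix `X`. -/
def pauliX : Matrix (ZMod 2) (ZMod 2) ℂ :=
  Matrix.of fun a b => if a = b then 0 else 1

/-- The Pauli matrix `Z`. -/
def pauliZ : Matrix (ZMod 2) (ZMod 2) ℂ :=
  Matrix.diagonal fun a => if a = 0 then 1 else -1

/-- The `n`-qubit Pauli matrix `X^u Z^v`, the tensor product of the matrices
`X^{u_i} Z^{v_i}`. -/
noncomputable def pauli {n : ℕ} (u v : Fin n → ZMod 2) :
    Matrix (Fin n → ZMod 2) (Fin n → ZMod 2) ℂ :=
  Matrix.of fun a b => ∏ i, (pauliX ^ (u i).val * pauliZ ^ (v i).val) (a i) (b i)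

/-- The weight of `X^u Z^v`: the number of its tensor factors different from the identity. -/
def pauliWeight {n : ℕ} (u v : Fin n → ZMod 2) : ℕ :=
  (Finset.univ.filter fun i => u i ≠ 0 ∨ v i ≠ 0).card

/-- The error `E` is detectable by the code `Q` (Knill–Laflamme condition `P E P = c P`, where
`P` is the orthogonal projection onto `Q`). -/
def IsDetectable {n : ℕ} (Q : Submodule ℂ (QubitSpace n))
    (E : Matrix (Fin n → ZMod 2) (Fin n → ZMod 2) ℂ) : Prop :=
  ∃ c : ℂ, ∀ x ∈ Q, ∀ y ∈ Q, star x ⬝ᵥ (E *ᵥ y) = c * (star x ⬝ᵥ y)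

/-- `Q` is an `[[n, k, d]]` binary quantum code: a `2^k`-dimensional subspace of the state space
of `n` qubits whose minimum distance is exactly `d`. The minimum distance is the least weight of
an undetectable Pauli error. A one-dimensional code (`k = 0`) detects everything; there, as usual,
one takes the least weight of a nonidentity Pauli error with nonzero expectation on the code. -/
structure IsQuantumCode {n : ℕ} (Q : Submodule ℂ (QubitSpace n)) (k d : ℕ) : Prop where
  dim : Module.finrank ℂ Q = 2 ^ k
  dist : 0 < k → IsLeast {w | ∃ u v, ¬ IsDetectable Q (pauli u v) ∧ pauliWeight u v = w} d
  dist_zero : k = 0 →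
    IsLeast {w | ∃ u v, 0 < pauliWeight u v ∧ (∃ x ∈ Q, star x ⬝ᵥ (pauli u v *ᵥ x) ≠ 0) ∧
      pauliWeight u v = w} d

/-- The CSS code of `C₂ ⊆ C₁`: the common `+1`-eigenspace of the operators `X^u` with `u ∈ C₂`
and `Z^v` with `v ∈ C₁^⊥`. -/
noncomputable def cssCode {n : ℕ} (C₁ C₂ : BinaryCode n) : Submodule ℂ (QubitSpace n) where
  carrier := {x | (∀ u ∈ C₂, pauli u 0 *ᵥ x = x) ∧ ∀ v ∈ dual C₁, pauli 0 v *ᵥ x = x}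
  add_mem' := by
    rintro x y ⟨hx, hx'⟩ ⟨hy, hy'⟩
    refine ⟨fun u hu => ?_, fun v hv => ?_⟩
    · rw [Matrix.mulVec_add, hx u hu, hy u hu]
    · rw [Matrix.mulVec_add, hx' v hv, hy' v hv]
  zero_mem' := ⟨fun _ _ => Matrix.mulVec_zero _, fun _ _ => Matrix.mulVec_zero _⟩
  smul_mem' := by
    rintro r x ⟨hx, hx'⟩
    refine ⟨fun u hu => ?_, fun v hv => ?_⟩
    · rw [Matrix.mulVec_smul, hx u hu]
    · rw [Matrix.mulVec_smul, hx' v hv]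

end Quantum

end TriadicCode

namespace TriadicCode

/-! ### Cyclic codes via the discrete Fourier transform over `F` -/

section Fourier

set_option linter.unusedSectionVars false

variable {n : ℕ} [NeZero n] {F : Type*} [Field F] [Algebra (ZMod 2) F] {α : F}

/-! A cyclic code with defining set `A` consists of the vectors whose Fourier coefficients c(α^t)
vanish on `A` (`zeroCode`). Its dimension is n - |A|, and by Parseval its dual has defining set {t |
-t ∉ A} (`dual_zeroCode`). With m the common size of the `X i`, n = |Xinf| + 3m, so dim C₁ - dim C₂
= |Xinf| + m = (n + 2|Xinf|)/3. CSS states are functions on C₁/C₂, which gives the dimension of the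
quantum code. A Pauli error X^u Z^v is undetectable only if u ∈ C₁, v ∈ C₂^⊥, and u ∉ C₂ or v ∉
C₁^⊥. Conversely X^u is undetectable for u ∈ C₁ \ C₂. So the distance is d once every v ∈ C₂^⊥ \
C₁^⊥ has weight at least d. If k is the third index, C₂^⊥ has defining set -X_k, and a multiplier
carries X_i onto it. Multipliers permute coordinates, so v becomes a vector of C₁ of equal weight;
should it land in C₂, a second multiplier moves it out while staying in C₁
(`exists_hammingNorm_eq`). -/

theorem val_finEquiv (i : Fin n) : (ZMod.finEquiv n i).val = i := by
  cases n with
  | zero => exact i.elim0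
  | succ m => rfl

/-- The additive character `t ↦ α^t` of `ZMod n`. -/
noncomputable def rootChar (hα : IsPrimitiveRoot α n) : AddChar (ZMod n) F :=
  AddChar.zmodChar n hα.pow_eq_one

theorem rootChar_isPrimitive (hα : IsPrimitiveRoot α n) : (rootChar hα).IsPrimitive :=
  AddChar.zmodChar_primitive_of_primitive_root n hα

theorem rootChar_apply (hα : IsPrimitiveRoot α n) (t : ZMod n) : rootChar hα t = α ^ t.val :=
  AddChar.zmodChar_apply hα.pow_eq_one t

theorem pow_val_injective (hα : IsPrimitiveRoot α n) :
    Function.Injective fun t : ZMod n => α ^ t.val := fun s t h =>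
  ZMod.val_injective n (hα.pow_inj s.val_lt t.val_lt h)

theorem pow_val_pow (hα : IsPrimitiveRoot α n) (t : ZMod n) : (α ^ t.val) ^ n = 1 := by
  rw [← pow_mul, mul_comm, pow_mul, hα.pow_eq_one, one_pow]

/-- The Fourier coefficient `c(α^t)` of `c`. -/
noncomputable def fourier (α : F) (c : Fin n → ZMod 2) (t : ZMod n) : F :=
  Polynomial.aeval (α ^ t.val) (toPoly c)

/-- In this form frequency and position enter symmetrically: multipliers on `t` become coordinate
permutations, and character orthogonality applies. -/
theorem fourier_eq_sum (hα : IsPrimitiveRoot α n) (c : Fin n → ZMod 2) (t : ZMod n) :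
    fourier α c t =
      ∑ i, algebraMap (ZMod 2) F (c i) * rootChar hα (t * ZMod.finEquiv n i) := by
  simp only [fourier, toPoly, map_sum, map_mul, map_pow, Polynomial.aeval_C, Polynomial.aeval_X]
  refine Finset.sum_congr rfl fun i _ => ?_
  have h : (t * ZMod.finEquiv n i) = (i : ℕ) • t := by
    rw [nsmul_eq_mul, mul_comm, ← val_finEquiv i, ZMod.natCast_zmod_val]
  rw [h, AddChar.map_nsmul_eq_pow, rootChar_apply]

theorem toPoly_add (a b : Fin n → ZMod 2) : toPoly (a + b) = toPoly a + toPoly b := by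
  simp [toPoly, add_mul, Finset.sum_add_distrib]

theorem toPoly_smul (r : ZMod 2) (a : Fin n → ZMod 2) :
    toPoly (r • a) = Polynomial.C r * toPoly a := by
  simp [toPoly, mul_assoc, Finset.mul_sum]

/-- The code of the vectors whose Fourier coefficients vanish on `A`. -/
noncomputable def zeroCode (α : F) (A : Set (ZMod n)) : BinaryCode n where
  carrier := {c | ∀ t ∈ A, fourier α c t = 0}
  add_mem' := by
    intro a b ha hb t ht
    have h1 := ha t ht
    have h2 := hb t ht
    rw [fourier] at *
    rw [toPoly_add, map_add, h1, h2, add_zero]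
  zero_mem' := by
    intro t _
    simp [fourier, toPoly]
  smul_mem' := by
    intro r a ha t ht
    have h1 := ha t ht
    rw [fourier] at *
    rw [toPoly_smul, map_mul, h1, mul_zero]

theorem mem_zeroCode {A : Set (ZMod n)} {c : Fin n → ZMod 2} :
    c ∈ zeroCode α A ↔ ∀ t ∈ A, fourier α c t = 0 := Iff.rfl

theorem zeroCode_anti {A B : Set (ZMod n)} (h : A ⊆ B) : zeroCode α B ≤ zeroCode α A :=
  fun _ hc t ht => hc t (h ht)

theorem natCast_ne_zero_of_odd (hn : Odd n) : (n : F) ≠ 0 := by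
  obtain ⟨k, hk⟩ := hn
  have h : (n : ZMod 2) = 1 := by
    rw [hk]
    push_cast
    rw [show (2 : ZMod 2) = 0 from rfl, zero_mul, zero_add]
  rw [← map_natCast (algebraMap (ZMod 2) F), h, map_one]
  exact one_ne_zero

/-- A divisor of `x^n - 1` divides the polynomials vanishing at its roots. -/
theorem dvd_iff_aeval_eq_zero (hn : Odd n) (hα : IsPrimitiveRoot α n) {g : (ZMod 2)[X]}
    (hg : g ∣ Polynomial.X ^ n - 1) (p : (ZMod 2)[X]) :
    g ∣ p ↔ ∀ t : ZMod n, Polynomial.aeval (α ^ t.val) g = 0 →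
      Polynomial.aeval (α ^ t.val) p = 0 := by
  classical
  refine ⟨fun ⟨q, hq⟩ t ht => by rw [hq, map_mul, ht, zero_mul], fun h => ?_⟩
  by_cases hp : p = 0
  · simp [hp]
  have hp' : p.map (algebraMap (ZMod 2) F) ≠ 0 :=
    (Polynomial.map_ne_zero_iff (algebraMap (ZMod 2) F).injective).mpr hp
  have hdvd : g.map (algebraMap (ZMod 2) F) ∣ Polynomial.X ^ n - Polynomial.C 1 := by
    simpa using Polynomial.map_dvd (algebraMap (ZMod 2) F) hg
  have hne : (Polynomial.X ^ n - Polynomial.C 1 : F[X]) ≠ 0 :=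
    Polynomial.X_pow_sub_C_ne_zero (NeZero.pos n) 1
  have hg0 := ne_zero_of_dvd_ne_zero hne hdvd
  rw [← Polynomial.map_dvd_map' (algebraMap (ZMod 2) F)]
  refine ((X_pow_sub_C_splits_of_isPrimitiveRoot hα (one_pow n)).of_dvd hne
    hdvd).dvd_of_roots_le_roots hg0 ?_
  -- Since n is odd, x^n - 1 is separable over `F`, so comparing sets of roots suffices.
  have hnodup := Polynomial.nodup_roots (Polynomial.Separable.of_dvd
    (Polynomial.separable_X_pow_sub_C 1 (natCast_ne_zero_of_odd (F := F) hn) one_ne_zero) hdvd)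
  rw [Multiset.le_iff_subset hnodup]
  intro x hx
  rw [Polynomial.mem_roots hg0] at hx
  have hxn : x ^ n = 1 := by
    have := hx.dvd hdvd
    simpa [Polynomial.IsRoot, sub_eq_zero] using this
  obtain ⟨i, hi, rfl⟩ := hα.eq_pow_of_pow_eq_one hxn
  rw [Polynomial.mem_roots hp']
  have hi' : ((i : ZMod n)).val = i := ZMod.val_cast_of_lt hi
  have := h i
  rw [hi', Polynomial.aeval_def, Polynomial.aeval_def, ← Polynomial.eval_map,
    ← Polynomial.eval_map] at this
  exact this hx

theorem eq_zeroCode_of_hasDefiningSet (hn : Odd n) (hα : IsPrimitiveRoot α n)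
    {C : BinaryCode n} {A : Set (ZMod n)} (h : HasDefiningSet α C A) : C = zeroCode α A := by
  obtain ⟨-, g, ⟨-, hg, hC⟩, rfl⟩ := h
  ext c
  rw [hC, dvd_iff_aeval_eq_zero hn hα hg]
  rfl

/-- A cyclic shift multiplies the coefficient at `t` by α^t. -/
theorem isCyclic_zeroCode (hα : IsPrimitiveRoot α n) (A : Set (ZMod n)) :
    IsCyclic (zeroCode α A) := by
  intro c hc t ht
  have h := hc t ht
  have hrot : ∀ i, ZMod.finEquiv n (finRotate n i) = ZMod.finEquiv n i + 1 := by
    intro i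
    rw [finRotate_apply, map_add, map_one]
  rw [fourier_eq_sum hα] at h ⊢
  refine (Equiv.sum_comp (finRotate n) _).symm.trans ?_
  simp only [Function.comp_apply, Equiv.symm_apply_apply, hrot, mul_add, mul_one,
    AddChar.map_add_eq_mul]
  simp only [← mul_assoc]
  rw [← Finset.sum_mul, h, zero_mul]

/-- A set of exponents closed under doubling is the set of roots of a binary polynomial. -/
theorem exists_monic_aeval_eq_zero_iff (hα : IsPrimitiveRoot α n)
    {A : Set (ZMod n)} (hn : Odd n) (hA : ∀ t ∈ A, t * 2 ∈ A) :
    ∃ g : (ZMod 2)[X], g.Monic ∧ g.natDegree = A.ncard ∧ g ∣ Polynomial.X ^ n - 1 ∧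
      A = {t | Polynomial.aeval (α ^ t.val) g = 0} := by
  classical
  have : CharP F 2 := charP_of_injective_algebraMap (algebraMap (ZMod 2) F).injective 2
  have : ExpChar F 2 := ExpChar.prime Nat.prime_two
  set P : F[X] := ∏ t ∈ A.toFinset, (Polynomial.X - Polynomial.C (α ^ t.val)) with hP
  have hPm : P.Monic := Polynomial.monic_prod_of_monic _ _ fun t _ => Polynomial.monic_X_sub_C _
  have h2 : Function.Injective fun t : ZMod n => t * 2 := by
    have hu : IsUnit (2 : ZMod n) := by
      have := (ZMod.isUnit_iff_coprime 2 n).mpr (Nat.coprime_two_left.mpr hn)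
      exact_mod_cast this
    exact hu.mul_left_injective
  have himage : A.toFinset.image (fun t => t * 2) = A.toFinset := by
    refine Finset.eq_of_subset_of_card_le (fun s hs => ?_)
      (Finset.card_image_of_injective _ h2).ge
    obtain ⟨t, ht, rfl⟩ := Finset.mem_image.mp hs
    exact Set.mem_toFinset.mpr (hA t (Set.mem_toFinset.mp ht))
  -- Squaring sends α^t to α^(2t), so Frobenius permutes the linear factors of `P`. Its coefficients
  -- then satisfy x² = x and lie in {0, 1}.
  have hfrob : P.map (frobenius F 2) = P := by
    conv_rhs => rw [hP, ← himage, Finset.prod_image fun _ _ _ _ h => h2 h]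
    rw [hP, Polynomial.map_prod]
    refine Finset.prod_congr rfl fun t _ => ?_
    rw [Polynomial.map_sub, Polynomial.map_X, Polynomial.map_C, frobenius_def,
      ← rootChar_apply hα, ← rootChar_apply hα, ← AddChar.map_nsmul_eq_pow, nsmul_eq_mul, mul_comm]
    rfl
  have hlift : P ∈ Polynomial.lifts (algebraMap (ZMod 2) F) := by
    rw [Polynomial.lifts_iff_coeff_lifts]
    intro k
    have hk : P.coeff k ^ 2 = P.coeff k := by
      conv_rhs => rw [← hfrob, Polynomial.coeff_map, frobenius_def]
    have hk' : P.coeff k * (P.coeff k - 1) = 0 := by linear_combination hk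
    rcases mul_eq_zero.mp hk' with h | h
    · exact ⟨0, by rw [map_zero, h]⟩
    · exact ⟨1, by rw [map_one, sub_eq_zero.mp h]⟩
  obtain ⟨g, hgP, hdeg, hgm⟩ := Polynomial.lifts_and_natDegree_eq_and_monic hlift hPm
  refine ⟨g, hgm, ?_, ?_, ?_⟩
  · rw [hdeg, hP, Polynomial.natDegree_prod_of_monic _ _ fun t _ => Polynomial.monic_X_sub_C _]
    simp only [Polynomial.natDegree_X_sub_C, Finset.sum_const, smul_eq_mul, mul_one,
      Set.ncard_eq_toFinset_card']
  · rw [← Polynomial.map_dvd_map' (algebraMap (ZMod 2) F), hgP]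
    refine Finset.prod_dvd_of_coprime (fun s _ t _ hst =>
      Polynomial.pairwise_coprime_X_sub_C (pow_val_injective hα) hst) fun t _ => ?_
    rw [Polynomial.dvd_iff_isRoot]
    simp [Polynomial.IsRoot, pow_val_pow hα]
  · ext t
    rw [Set.mem_ofPred_eq, Polynomial.aeval_def, ← Polynomial.eval_map, hgP, hP,
      Polynomial.eval_prod, Finset.prod_eq_zero_iff]
    simp only [Set.mem_toFinset, Polynomial.eval_sub, Polynomial.eval_X, Polynomial.eval_C,
      sub_eq_zero]
    exact ⟨fun h => ⟨t, h, rfl⟩, fun ⟨s, hs, h⟩ => pow_val_injective hα h ▸ hs⟩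

theorem hasDefiningSet_zeroCode (hn : Odd n) (hα : IsPrimitiveRoot α n)
    {A : Set (ZMod n)} (hA : ∀ t ∈ A, t * 2 ∈ A) : HasDefiningSet α (zeroCode α A) A := by
  obtain ⟨g, hgm, -, hdvd, hroots⟩ := exists_monic_aeval_eq_zero_iff hα hn hA
  refine ⟨isCyclic_zeroCode hα A, g, ⟨hgm, hdvd, fun c => ?_⟩, hroots⟩
  rw [dvd_iff_aeval_eq_zero hn hα hdvd, mem_zeroCode]
  conv_lhs => rw [hroots]
  rfl

/-- Vectors of length `n` as polynomials of degree less than `n`. -/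
noncomputable def toPolyLinear (n : ℕ) [NeZero n] : (Fin n → ZMod 2) →ₗ[ZMod 2] (ZMod 2)[X] where
  toFun := toPoly
  map_add' := toPoly_add
  map_smul' r a := by rw [toPoly_smul, RingHom.id_apply, Polynomial.smul_eq_C_mul]

theorem exists_toPoly_eq {p : (ZMod 2)[X]} (hp : p.degree < n) :
    ∃ c : Fin n → ZMod 2, toPoly c = p := by
  refine ⟨fun i => p.coeff i, ?_⟩
  have h : p.natDegree < n := by
    by_cases h0 : p = 0
    · simpa [h0] using NeZero.pos n
    · exact (Polynomial.natDegree_lt_iff_degree_lt h0).mpr hp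
  conv_rhs => rw [p.as_sum_range' n h]
  rw [toPoly, Fin.sum_univ_eq_sum_range (fun i => Polynomial.C (p.coeff i) * Polynomial.X ^ i)]
  simp only [Polynomial.C_mul_X_pow_eq_monomial]

/-- The code is the kernel of reduction modulo its generator `g` on polynomials of degree below n.
Reduction is onto because remainders have degree below deg g ≤ n, and the quotient has dimension deg
g = |A|. -/
theorem finrank_zeroCode (hn : Odd n) (hα : IsPrimitiveRoot α n)
    {A : Set (ZMod n)} (hA : ∀ t ∈ A, t * 2 ∈ A) :
    Module.finrank (ZMod 2) (zeroCode α A) = n - A.ncard := by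
  obtain ⟨g, hgm, hdeg, hdvd, hroots⟩ := exists_monic_aeval_eq_zero_iff hα hn hA
  have hle : g.natDegree ≤ n := by
    have := Polynomial.natDegree_le_of_dvd hdvd
      (by simpa using Polynomial.X_pow_sub_C_ne_zero (NeZero.pos n) (1 : ZMod 2))
    rwa [← Polynomial.C_1, Polynomial.natDegree_X_pow_sub_C] at this
  let f : (Fin n → ZMod 2) →ₗ[ZMod 2] ((ZMod 2)[X] ⧸ Ideal.span {g}) :=
    (Ideal.Quotient.mkₐ (ZMod 2) (Ideal.span {g})).toLinearMap ∘ₗ toPolyLinear n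
  have hker : LinearMap.ker f = zeroCode α A := by
    ext c
    have : c ∈ zeroCode α A ↔ g ∣ toPoly c := by
      rw [dvd_iff_aeval_eq_zero hn hα hdvd, mem_zeroCode]
      conv_lhs => rw [hroots]
      rfl
    rw [this, LinearMap.mem_ker, ← Ideal.mem_span_singleton, ← Ideal.Quotient.eq_zero_iff_mem]
    rfl
  have hsurj : LinearMap.range f = ⊤ := by
    rw [LinearMap.range_eq_top]
    intro q
    obtain ⟨p, rfl⟩ := Ideal.Quotient.mk_surjective q
    have hlt : (p %ₘ g).degree < n :=
      (Polynomial.degree_modByMonic_lt p hgm).trans_le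
        (Polynomial.degree_le_natDegree.trans (by exact_mod_cast hle))
    obtain ⟨c, hc⟩ := exists_toPoly_eq hlt
    refine ⟨c, ?_⟩
    change Ideal.Quotient.mk _ (toPoly c) = _
    rw [Ideal.Quotient.eq, Ideal.mem_span_singleton, hc]
    exact ⟨-(p /ₘ g), by linear_combination Polynomial.modByMonic_add_div p g⟩
  have := f.finrank_range_add_finrank_ker
  rw [hker, hsurj, finrank_top, finrank_quotient_span_eq_natDegree, hdeg,
    Module.finrank_fin_fun] at this
  omega

/-- Parseval's identity. -/
theorem sum_fourier_neg_mul_fourier (hα : IsPrimitiveRoot α n) (v c : Fin n → ZMod 2) :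
    ∑ t, fourier α v (-t) * fourier α c t = n * algebraMap (ZMod 2) F (v ⬝ᵥ c) := by
  classical
  have h : ∀ t, fourier α v (-t) * fourier α c t =
      ∑ i, ∑ j, algebraMap (ZMod 2) F (v i) * algebraMap (ZMod 2) F (c j) *
        rootChar hα (t * (ZMod.finEquiv n j - ZMod.finEquiv n i)) := by
    intro t
    rw [fourier_eq_sum hα, fourier_eq_sum hα, Finset.sum_mul_sum]
    refine Finset.sum_congr rfl fun i _ => Finset.sum_congr rfl fun j _ => ?_
    rw [show t * (ZMod.finEquiv n j - ZMod.finEquiv n i) =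
      -t * ZMod.finEquiv n i + t * ZMod.finEquiv n j by ring, AddChar.map_add_eq_mul]
    ring
  simp only [h]
  rw [Finset.sum_comm, dotProduct, map_sum, Finset.mul_sum]
  refine Finset.sum_congr rfl fun i _ => ?_
  rw [Finset.sum_comm]
  simp only [← Finset.mul_sum, AddChar.sum_mulShift _ (rootChar_isPrimitive hα), sub_eq_zero,
    EmbeddingLike.apply_eq_iff_eq, ZMod.card]
  simp only [Nat.cast_ite, Nat.cast_zero, mul_ite, mul_zero, Finset.sum_ite_eq', Finset.mem_univ,
    if_true, map_mul]
  ring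

theorem eq_zero_of_fourier_eq_zero (hn : Odd n) (hα : IsPrimitiveRoot α n)
    {v : Fin n → ZMod 2} (h : ∀ t, fourier α v t = 0) : v = 0 := by
  refine dotProduct_eq_zero v fun c => ?_
  have := sum_fourier_neg_mul_fourier hα v c
  simp only [h, zero_mul, Finset.sum_const_zero] at this
  have := (mul_eq_zero.mp this.symm).resolve_left (natCast_ne_zero_of_odd hn)
  exact (map_eq_zero _).mp this

/-- Every term of Parseval's sum has a vanishing factor, and n is nonzero in `F`. -/
theorem mem_dual_zeroCode_of_forall (hn : Odd n) (hα : IsPrimitiveRoot α n)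
    {A : Set (ZMod n)} {v : Fin n → ZMod 2} (h : ∀ t ∉ A, fourier α v (-t) = 0) :
    v ∈ dual (zeroCode α A) := by
  intro c hc
  have := sum_fourier_neg_mul_fourier hα v c
  rw [Finset.sum_eq_zero fun t _ => ?_] at this
  · have := (mul_eq_zero.mp this.symm).resolve_left (natCast_ne_zero_of_odd hn)
    exact (map_eq_zero _).mp this
  · by_cases ht : t ∈ A
    · rw [hc t ht, mul_zero]
    · rw [h t ht, zero_mul]

end Fourier

/-! ### Pauli errors on CSS codes -/

section Stabilizer

variable {n : ℕ}

/-- The character `(-1)^a` of `ZMod 2`. -/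
noncomputable def sign (a : ZMod 2) : ℂ := if a = 0 then 1 else -1

theorem sign_zero : sign 0 = 1 := if_pos rfl

theorem sign_one : sign 1 = -1 := if_neg (by decide)

theorem zmod_two_eq_one {a : ZMod 2} (h : a ≠ 0) : a = 1 := by
  revert h; revert a; decide

theorem sign_add (a b : ZMod 2) : sign (a + b) = sign a * sign b := by
  by_cases ha : a = 0
  · simp [ha, sign_zero]
  by_cases hb : b = 0
  · simp [hb, sign_zero]
  rw [zmod_two_eq_one ha, zmod_two_eq_one hb, show (1 + 1 : ZMod 2) = 0 from rfl, sign_zero,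
    sign_one]
  norm_num

theorem sign_sum {ι : Type*} (s : Finset ι) (f : ι → ZMod 2) :
    sign (∑ i ∈ s, f i) = ∏ i ∈ s, sign (f i) := by
  classical
  induction s using Finset.induction_on with
  | empty => simp [sign_zero]
  | insert a s ha ih => rw [Finset.sum_insert ha, Finset.prod_insert ha, sign_add, ih]

theorem pauliX_pow (u : ZMod 2) :
    pauliX ^ u.val = Matrix.of fun a b => if b = a + u then 1 else 0 := by
  by_cases hu : u = 0
  · subst hu
    ext a b
    rw [ZMod.val_zero, pow_zero, Matrix.one_apply, Matrix.of_apply, add_zero]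
    simp only [eq_comm]
  · obtain rfl := zmod_two_eq_one hu
    ext a b
    have : a = b ↔ b ≠ a + 1 := by revert a b; decide
    simp [ZMod.val_one, pauliX, this]

theorem pauliZ_pow (v : ZMod 2) : pauliZ ^ v.val = Matrix.diagonal fun b => sign (v * b) := by
  by_cases hv : v = 0
  · subst hv
    simp [sign_zero]
  · obtain rfl := zmod_two_eq_one hv
    simp [ZMod.val_one, pauliZ, sign]

theorem pauliX_pow_mul_pauliZ_pow (u v a b : ZMod 2) :
    (pauliX ^ u.val * pauliZ ^ v.val) a b = if b = a + u then sign (v * b) else 0 := by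
  simp [pauliX_pow, pauliZ_pow, Matrix.mul_diagonal]

theorem pauli_mulVec (u v : Fin n → ZMod 2) (x : QubitSpace n) (a : Fin n → ZMod 2) :
    (pauli u v *ᵥ x) a = sign (v ⬝ᵥ (a + u)) * x (a + u) := by
  have h : ∀ b, pauli u v a b = if b = a + u then sign (v ⬝ᵥ b) else 0 := by
    intro b
    simp only [pauli, Matrix.of_apply, pauliX_pow_mul_pauliZ_pow]
    split_ifs with hb
    · subst hb
      simp [dotProduct, sign_sum]
    · obtain ⟨i, hi⟩ := Function.ne_iff.mp hb
      exact Finset.prod_eq_zero (Finset.mem_univ i) (if_neg hi)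
  simp [Matrix.mulVec, dotProduct, h]

theorem mem_dual {C : BinaryCode n} {v : Fin n → ZMod 2} :
    v ∈ dual C ↔ ∀ c ∈ C, v ⬝ᵥ c = 0 := Iff.rfl

theorem dual_eq_orthogonal (C : BinaryCode n) :
    dual C = LinearMap.BilinForm.orthogonal (dotProductBilin (ZMod 2) (ZMod 2)) C := by
  ext v
  simp only [mem_dual, LinearMap.BilinForm.mem_orthogonal_iff]
  exact forall₂_congr fun c _ => by rw [dotProduct_comm]; rfl

theorem dotProductBilin_nondegenerate :
    (dotProductBilin (ZMod 2) (ZMod 2) :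
      LinearMap.BilinForm (ZMod 2) (Fin n → ZMod 2)).Nondegenerate := by
  refine ⟨fun x hx => ?_, fun x hx => ?_⟩
  · exact dotProduct_eq_zero _ hx
  · exact dotProduct_eq_zero _ fun y => by rw [dotProduct_comm]; exact hx y

theorem dotProductBilin_isRefl :
    (dotProductBilin (ZMod 2) (ZMod 2) :
      LinearMap.BilinForm (ZMod 2) (Fin n → ZMod 2)).IsRefl := by
  intro x y h
  change y ⬝ᵥ x = 0
  rw [dotProduct_comm]
  exact h

theorem finrank_dual (C : BinaryCode n) :
    Module.finrank (ZMod 2) (dual C) = n - Module.finrank (ZMod 2) C := by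
  rw [dual_eq_orthogonal,
    LinearMap.BilinForm.finrank_orthogonal dotProductBilin_nondegenerate, Module.finrank_fin_fun]

theorem dual_dual (C : BinaryCode n) : dual (dual C) = C := by
  rw [dual_eq_orthogonal, dual_eq_orthogonal,
    LinearMap.BilinForm.orthogonal_orthogonal dotProductBilin_nondegenerate
      dotProductBilin_isRefl]

theorem add_self_vec (u : Fin n → ZMod 2) : u + u = 0 := by
  ext i
  exact CharTwo.add_self_eq_zero _

/-- The X-stabilizers impose invariance under translation by C₂; the Z-stabilizers confine the
support to (C₁^⊥)^⊥ = C₁. -/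
theorem mem_cssCode {C₁ C₂ : BinaryCode n} {x : QubitSpace n} :
    x ∈ cssCode C₁ C₂ ↔ (∀ u ∈ C₂, ∀ a, x (a + u) = x a) ∧ ∀ a, x a ≠ 0 → a ∈ C₁ := by
  refine and_congr (forall₂_congr fun u _ => ?_) ⟨fun h a ha => ?_, fun h v hv => ?_⟩
  · simp [funext_iff, pauli_mulVec, sign_zero]
  · rw [← dual_dual C₁]
    intro v hv
    by_contra hav
    have := congr_fun (h v hv) a
    rw [pauli_mulVec, add_zero, dotProduct_comm, zmod_two_eq_one hav, sign_one] at this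
    exact ha (by linear_combination (-1 / 2 : ℂ) * this)
  · ext a
    rw [pauli_mulVec, add_zero]
    by_cases ha : x a = 0
    · simp [ha]
    · rw [hv a (h a ha), sign_zero, one_mul]

/-- States of the CSS code are the functions on `C₁ / C₂`. -/
noncomputable def cssCodeEquiv {C₁ C₂ : BinaryCode n} (h : C₂ ≤ C₁) :
    cssCode C₁ C₂ ≃ₗ[ℂ] (C₁ ⧸ C₂.submoduleOf C₁ → ℂ) where
  toFun x q := Quotient.liftOn' q (fun a => x.1 a) fun a b hab => by
    have hm : a.1 - b.1 ∈ C₂ := (Submodule.quotientRel_def (C₂.submoduleOf C₁)).mp hab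
    have := (mem_cssCode.mp x.2).1 _ hm b.1
    simpa using this
  map_add' x y := by
    ext q
    induction q using Quotient.inductionOn'
    rfl
  map_smul' r x := by
    ext q
    induction q using Quotient.inductionOn'
    rfl
  invFun f := by
    classical
    exact ⟨fun a => if ha : a ∈ C₁ then f (Submodule.Quotient.mk ⟨a, ha⟩) else 0, by
      rw [mem_cssCode]
      refine ⟨fun u hu a => ?_, fun a ha => ?_⟩
      · by_cases ha : a ∈ C₁
        · rw [dif_pos ha, dif_pos (add_mem ha (h hu))]
          congr 1
          rw [Submodule.Quotient.eq]
          change a + u - a ∈ C₂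
          rwa [add_sub_cancel_left]
        · rw [dif_neg ha, dif_neg ((Submodule.add_mem_iff_left _ (h hu)).not.mpr ha)]
      · by_contra h'
        exact ha (dif_neg h')⟩
  left_inv x := by
    ext a
    by_cases ha : a ∈ C₁
    · simp only [ha, dite_true]
      rfl
    · simp only [ha, dite_false]
      by_contra h'
      exact ha ((mem_cssCode.mp x.2).2 a (Ne.symm h'))
  right_inv f := by
    ext q
    induction q using Quotient.inductionOn' with
    | h a => exact dif_pos a.2

theorem finrank_cssCode {C₁ C₂ : BinaryCode n} (h : C₂ ≤ C₁) :
    Module.finrank ℂ (cssCode C₁ C₂) =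
      2 ^ (Module.finrank (ZMod 2) C₁ - Module.finrank (ZMod 2) C₂) := by
  classical
  have hq : Module.finrank (ZMod 2) (C₁ ⧸ C₂.submoduleOf C₁) =
      Module.finrank (ZMod 2) C₁ - Module.finrank (ZMod 2) C₂ := by
    have h1 := Submodule.finrank_quotient_add_finrank (C₂.submoduleOf C₁)
    have h2 := (Submodule.submoduleOfEquivOfLe h).finrank_eq
    omega
  have : Fintype (C₁ ⧸ C₂.submoduleOf C₁) := Fintype.ofFinite _
  rw [(cssCodeEquiv h).finrank_eq, Module.finrank_pi, ← hq, ← Nat.card_eq_fintype_card,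
    Module.natCard_eq_pow_finrank (K := ZMod 2), Nat.card_zmod]

/-- Translation by `u` moves supports off C₁, so all matrix elements vanish. -/
theorem isDetectable_of_notMem_left {C₁ C₂ : BinaryCode n} {u v : Fin n → ZMod 2}
    (hu : u ∉ C₁) : IsDetectable (cssCode C₁ C₂) (pauli u v) := by
  refine ⟨0, fun x hx y hy => ?_⟩
  rw [zero_mul]
  refine Finset.sum_eq_zero fun a _ => ?_
  rw [pauli_mulVec]
  by_cases hxa : x a = 0
  · simp [hxa]
  by_cases hya : y (a + u) = 0
  · simp [hya]
  exact absurd ((Submodule.add_mem_iff_right _ ((mem_cssCode.mp hx).2 a hxa)).mp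
    ((mem_cssCode.mp hy).2 _ hya)) hu

/-- Some stabilizer X^w anticommutes with the error: substituting a + w for a negates the inner
product. -/
theorem isDetectable_of_notMem_right {C₁ C₂ : BinaryCode n} {u v : Fin n → ZMod 2}
    (hv : v ∉ dual C₂) : IsDetectable (cssCode C₁ C₂) (pauli u v) := by
  refine ⟨0, fun x hx y hy => ?_⟩
  rw [zero_mul]
  simp only [mem_dual, not_forall] at hv
  obtain ⟨w, hw, hvw⟩ := hv
  have key : star x ⬝ᵥ (pauli u v *ᵥ y) = -(star x ⬝ᵥ (pauli u v *ᵥ y)) := by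
    rw [dotProduct, ← Finset.sum_neg_distrib]
    refine (Equiv.sum_comp (Equiv.addRight w) _).symm.trans (Finset.sum_congr rfl fun a _ => ?_)
    have h1 : a + w + u = a + u + w := add_right_comm _ _ _
    simp only [Equiv.coe_addRight, pauli_mulVec, Pi.star_apply]
    rw [(mem_cssCode.mp hx).1 w hw a, h1, (mem_cssCode.mp hy).1 w hw, dotProduct_add, sign_add,
      zmod_two_eq_one hvw, sign_one]
    ring
  linear_combination (1 / 2 : ℂ) * key

theorem isDetectable_of_mem_stabilizer {C₁ C₂ : BinaryCode n} {u v : Fin n → ZMod 2}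
    (hu : u ∈ C₂) (hv : v ∈ dual C₁) : IsDetectable (cssCode C₁ C₂) (pauli u v) := by
  refine ⟨1, fun x _ y hy => ?_⟩
  have : pauli u v *ᵥ y = y := by
    ext a
    rw [pauli_mulVec, ← (mem_cssCode.mp hy).1 u hu a]
    by_cases hya : y (a + u) = 0
    · simp [hya]
    · rw [hv _ ((mem_cssCode.mp hy).2 _ hya), sign_zero, one_mul]
  rw [this, one_mul]

-- The indicators of C₂ and u + C₂ are orthogonal code states, yet X^u maps the second to the first;
-- detectability would force the first to have norm zero.
open scoped ComplexOrder in
theorem not_isDetectable_of_mem {C₁ C₂ : BinaryCode n} (h : C₂ ≤ C₁) {u : Fin n → ZMod 2}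
    (hu : u ∈ C₁) (hu' : u ∉ C₂) : ¬ IsDetectable (cssCode C₁ C₂) (pauli u 0) := by
  classical
  rintro ⟨c, hc⟩
  set x : QubitSpace n := fun a => if a ∈ C₂ then 1 else 0 with hxdef
  set y : QubitSpace n := fun a => if a + u ∈ C₂ then 1 else 0 with hydef
  have hx : x ∈ cssCode C₁ C₂ := by
    refine mem_cssCode.mpr ⟨fun w hw a => ?_, fun a ha => ?_⟩
    · simp only [hxdef, Submodule.add_mem_iff_left _ hw]
    · by_contra h'
      exact ha (if_neg fun h2 => h' (h h2))
  have hy : y ∈ cssCode C₁ C₂ := by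
    refine mem_cssCode.mpr ⟨fun w hw a => ?_, fun a ha => ?_⟩
    · simp only [hydef, add_right_comm a w u, Submodule.add_mem_iff_left _ hw]
    · by_contra h'
      exact ha (if_neg fun h2 => h' ((Submodule.add_mem_iff_left _ hu).mp (h h2)))
  have h1 := hc x hx y hy
  have hE : pauli u 0 *ᵥ y = x := by
    ext a
    rw [pauli_mulVec, zero_dotProduct, sign_zero, one_mul]
    simp only [hydef, hxdef, add_assoc, add_self_vec, add_zero]
  have hxy : star x ⬝ᵥ y = 0 := by
    refine Finset.sum_eq_zero fun a _ => ?_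
    simp only [hxdef, hydef, Pi.star_apply]
    by_cases ha : a ∈ C₂
    · rw [if_neg (c := a + u ∈ C₂) fun h2 => hu' ((Submodule.add_mem_iff_right _ ha).mp h2),
        mul_zero]
    · rw [if_neg ha, star_zero, zero_mul]
  rw [hE, hxy, mul_zero] at h1
  have := congr_fun (dotProduct_star_self_eq_zero.mp h1) 0
  simp [hxdef] at this

/-- The relative distance of `C₂ ⊆ C₁` is the minimum distance of the CSS code if `C₁^⊥ ⊆ C₂^⊥`
has no smaller relative distance. -/
theorem isLeast_undetectable {C₁ C₂ : BinaryCode n} (h : C₂ ≤ C₁) {d : ℕ}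
    (hd : IsRelativeDistance C₁ C₂ d)
    (hdual : ∀ v ∈ dual C₂, v ∉ dual C₁ → d ≤ hammingNorm v) :
    IsLeast {w | ∃ u v, ¬ IsDetectable (cssCode C₁ C₂) (pauli u v) ∧ pauliWeight u v = w} d := by
  classical
  refine ⟨?_, ?_⟩
  · obtain ⟨u, hu, hu', hw⟩ := hd.1
    refine ⟨u, 0, not_isDetectable_of_mem h hu hu', ?_⟩
    rw [← hw]
    simp [pauliWeight, hammingNorm]
  · rintro w ⟨u, v, huv, rfl⟩
    have hu : u ∈ C₁ := by
      by_contra hu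
      exact huv (isDetectable_of_notMem_left hu)
    have hv : v ∈ dual C₂ := by
      by_contra hv
      exact huv (isDetectable_of_notMem_right hv)
    -- The weight of X^u Z^v is at least that of `u` and that of `v`; one of them lies in a relative
    -- difference, as stabilizer elements are detectable.
    by_cases hu' : u ∈ C₂
    · refine (hdual v hv fun hv' => huv (isDetectable_of_mem_stabilizer hu' hv')).trans ?_
      exact Finset.card_le_card fun i hi => by simp_all
    · refine (hd.2 ⟨u, hu, hu', rfl⟩).trans ?_
      exact Finset.card_le_card fun i hi => by simp_all

end Stabilizer

/-! ### Multipliers and splittings -/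

section Multipliers

set_option linter.unusedSectionVars false

variable {n : ℕ} [NeZero n] {F : Type*} [Field F] [Algebra (ZMod 2) F] {α : F}

theorem IsUnionOfCosets.mul_two_pow_mem {A : Set (ZMod n)} (hA : IsUnionOfCosets A) {t : ZMod n}
    (ht : t ∈ A) (j : ℕ) : t * 2 ^ j ∈ A := by
  obtain ⟨T, rfl⟩ := hA
  simp only [Set.mem_iUnion] at ht ⊢
  obtain ⟨s, hs, k, rfl⟩ := ht
  exact ⟨s, hs, k + j, by simp only [pow_add, mul_assoc]⟩

/-- Doubling has finite order modulo odd n, so halving is a power of doubling. -/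
theorem IsUnionOfCosets.mul_two_mem_iff {A : Set (ZMod n)} (hA : IsUnionOfCosets A) (hn : Odd n)
    {t : ZMod n} : t * 2 ∈ A ↔ t ∈ A := by
  refine ⟨fun h => ?_, fun h => by simpa using hA.mul_two_pow_mem h 1⟩
  have h1 : (2 : ZMod n) ^ n.totient = 1 := by
    have := (ZMod.natCast_eq_natCast_iff _ _ _).mpr
      (Nat.ModEq.pow_totient (Nat.coprime_two_left.mpr hn))
    exact_mod_cast this
  have h2 := hA.mul_two_pow_mem h (n.totient - 1)
  rwa [mul_assoc, ← pow_succ', Nat.sub_add_cancel (Nat.totient_pos.mpr (NeZero.pos n)), h1,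
    mul_one] at h2

/-- Multiplying the exponents by a unit permutes the coordinates. -/
theorem exists_fourier_eq_fourier_mul (hα : IsPrimitiveRoot α n) (u : (ZMod n)ˣ)
    (c : Fin n → ZMod 2) :
    ∃ c' : Fin n → ZMod 2, hammingNorm c' = hammingNorm c ∧
      ∀ t, fourier α c' t = fourier α c (u * t) := by
  let σ : Fin n ≃ Fin n :=
    (ZMod.finEquiv n).toEquiv.trans ((Units.mulLeft u).trans (ZMod.finEquiv n).symm.toEquiv)
  refine ⟨c ∘ σ.symm, ?_, fun t => ?_⟩
  · refine Finset.card_bij (fun i _ => σ.symm i) (fun i hi => by simpa using hi)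
      (fun i _ j _ h => σ.symm.injective h) fun j hj => ⟨σ j, by simpa using hj, by simp⟩
  · rw [fourier_eq_sum hα, fourier_eq_sum hα]
    refine (Equiv.sum_comp σ _).symm.trans (Finset.sum_congr rfl fun i _ => ?_)
    have : ZMod.finEquiv n (σ i) = u * ZMod.finEquiv n i :=
      (ZMod.finEquiv n).apply_symm_apply _
    rw [Function.comp_apply, Equiv.symm_apply_apply, this, mul_left_comm, ← mul_assoc]

/-- Parseval gives one inclusion; both sides have dimension |A|. -/
theorem dual_zeroCode (hn : Odd n) (hα : IsPrimitiveRoot α n) {A : Set (ZMod n)}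
    (hA : ∀ t, t * 2 ∈ A ↔ t ∈ A) : dual (zeroCode α A) = zeroCode α {t | -t ∉ A} := by
  refine (Submodule.eq_of_le_of_finrank_eq (fun v hv => ?_) ?_).symm
  · exact mem_dual_zeroCode_of_forall hn hα fun t ht => hv (-t) (by simpa using ht)
  · have hcard : {t : ZMod n | -t ∉ A}.ncard = n - A.ncard := by
      have h1 : {t : ZMod n | -t ∉ A} = (fun t => -t) '' Aᶜ := by
        ext t
        simp
      rw [h1, Set.ncard_image_of_injective _ neg_injective, Set.ncard_compl, Nat.card_zmod]
    rw [finrank_dual, finrank_zeroCode hn hα fun t => (hA t).mpr, finrank_zeroCode hn hα, hcard]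
    intro t ht
    rw [Set.mem_ofPred_eq, ← neg_mul, hA]
    exact ht

namespace IsThreeSplitting

variable {Xinf : Set (ZMod n)} {X : Fin 3 → Set (ZMod n)}

theorem exists_unit (hX : IsThreeSplitting n Xinf X) :
    ∃ u : (ZMod n)ˣ, ∀ i, ∀ t : ZMod n, u * t ∈ X (i + 1) ↔ t ∈ X i := by
  obtain ⟨b, hb, hbX, -⟩ := hX.multiplier
  obtain ⟨u, hu⟩ := (ZMod.coe_int_isUnit_iff_isCoprime b n).mpr
    (Int.isCoprime_iff_gcd_eq_one.mpr hb)
  have hmul : ∀ t, mulMap n b t = u * t := fun t => by rw [mulMap, hu]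
  refine ⟨u, fun i t => ?_⟩
  rw [← hbX i]
  simp only [Set.mem_image, hmul, Units.mul_right_inj, exists_eq_right]

theorem exists_unit_shift (hX : IsThreeSplitting n Xinf X) (m : Fin 3) :
    ∃ u : (ZMod n)ˣ, ∀ i, ∀ t : ZMod n, u * t ∈ X (i + m) ↔ t ∈ X i := by
  obtain ⟨u, hu⟩ := hX.exists_unit
  fin_cases m
  · exact ⟨1, fun i t => by simp⟩
  · exact ⟨u, hu⟩
  · refine ⟨u * u, fun i t => ?_⟩
    have : i + (2 : Fin 3) = i + 1 + 1 := by revert i; decide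
    change _ ∈ X (i + (2 : Fin 3)) ↔ _
    rw [this, Units.val_mul, mul_assoc, hu, hu]

theorem ncard_eq (hX : IsThreeSplitting n Xinf X) (i j : Fin 3) :
    (X i).ncard = (X j).ncard := by
  obtain ⟨u, hu⟩ := hX.exists_unit_shift (j - i)
  have : X j = (fun t => (u : ZMod n) * t) '' X i := by
    ext t
    have h := hu i ((u⁻¹ : (ZMod n)ˣ) * t)
    rw [Units.mul_inv_cancel_left, add_sub_cancel] at h
    rw [h]
    exact ⟨fun ht => ⟨_, ht, by simp⟩, by rintro ⟨s, hs, rfl⟩; simpa using hs⟩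
  rw [this, Set.ncard_image_of_injective _ u.isUnit.mul_right_injective]

theorem ncard_union (hX : IsThreeSplitting n Xinf X) {i j : Fin 3} (hij : i ≠ j) :
    (Xinf ∪ X i ∪ X j).ncard = Xinf.ncard + (X i).ncard + (X j).ncard := by
  rw [Set.ncard_union_eq (Set.disjoint_union_left.mpr ⟨hX.disjoint_inf j, hX.disjoint i j hij⟩),
    Set.ncard_union_eq (hX.disjoint_inf i)]

theorem card_eq (hX : IsThreeSplitting n Xinf X) : n = Xinf.ncard + 3 * (X 0).ncard := by
  have h : (Xinf ∪ X 0 ∪ X 1 ∪ X 2).ncard = n := by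
    rw [hX.cover, Set.ncard_univ, Nat.card_zmod]
  have hd : Disjoint (Xinf ∪ X 0 ∪ X 1) (X 2) := by
    simp only [Set.disjoint_union_left]
    exact ⟨⟨hX.disjoint_inf 2, hX.disjoint 0 2 (by decide)⟩, hX.disjoint 1 2 (by decide)⟩
  rw [Set.ncard_union_eq hd, hX.ncard_union (by decide), hX.ncard_eq 1 0, hX.ncard_eq 2 0] at h
  omega

theorem mem_or (hX : IsThreeSplitting n Xinf X) (t : ZMod n) : t ∈ Xinf ∨ ∃ i, t ∈ X i := by
  rcases hX.cover.symm ▸ Set.mem_univ t with ((h | h) | h) | h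
  exacts [Or.inl h, Or.inr ⟨0, h⟩, Or.inr ⟨1, h⟩, Or.inr ⟨2, h⟩]

theorem mul_two_mem_union_iff (hX : IsThreeSplitting n Xinf X) (hn : Odd n) (i j : Fin 3)
    (t : ZMod n) : t * 2 ∈ Xinf ∪ X i ∪ X j ↔ t ∈ Xinf ∪ X i ∪ X j := by
  simp only [Set.mem_union, hX.coset_inf.mul_two_mem_iff hn, (hX.coset _).mul_two_mem_iff hn]

/-- Nonzero vectors of the dual of the even-like code have the weight of a vector of the odd-like
code outside the even-like code. -/
theorem exists_hammingNorm_eq (hX : IsThreeSplitting n Xinf X) (hn : Odd n)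
    (hα : IsPrimitiveRoot α n) {i j : Fin 3} (hij : i ≠ j) {v : Fin n → ZMod 2}
    (hv : v ∈ dual (zeroCode α (Xinf ∪ X i ∪ X j))) (hv0 : v ≠ 0) :
    ∃ c ∈ zeroCode α (X i), c ∉ zeroCode α (Xinf ∪ X i ∪ X j) ∧
      hammingNorm c = hammingNorm v := by
  rw [dual_zeroCode hn hα (hX.mul_two_mem_union_iff hn i j)] at hv
  -- `k` is the third index. The last equation is i + j + k = 0 modulo 3: the shift taking j to k
  -- takes i to j.
  obtain ⟨k, hik, hjk, hk, hjik⟩ : ∃ k : Fin 3, k ≠ i ∧ k ≠ j ∧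
      (∀ l, l = i ∨ l = j ∨ l = k) ∧ i + (k - j) = j := by
    clear hv
    revert i j
    decide
  obtain ⟨u, hu⟩ := hX.exists_unit_shift (k - i)
  -- The coefficients of `v` vanish on -X_k, and -u carries X_i onto -X_k.
  obtain ⟨c, hcv, hc⟩ := exists_fourier_eq_fourier_mul hα (-u) v
  have hci : c ∈ zeroCode α (X i) := by
    intro t ht
    have hk : (u : ZMod n) * t ∈ X k := by
      have := (hu i t).mpr ht
      rwa [add_sub_cancel] at this
    rw [hc]
    refine hv _ ?_
    rw [Set.mem_ofPred_eq, Units.val_neg, neg_mul, neg_neg]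
    rintro ((h | h) | h)
    · exact Set.disjoint_left.mp (hX.disjoint_inf k) h hk
    · exact Set.disjoint_left.mp (hX.disjoint k i hik) hk h
    · exact Set.disjoint_left.mp (hX.disjoint k j hjk) hk h
  -- If `c` is in C₂, its spectrum lies in X_k. Pulling back along `w` places it in X_j: the result
  -- still vanishes on X_i but not on all of X_j.
  by_cases hc2 : c ∈ zeroCode α (Xinf ∪ X i ∪ X j)
  · have hc0 : c ≠ 0 := by
      rwa [← hammingNorm_ne_zero_iff, hcv, hammingNorm_ne_zero_iff]
    obtain ⟨s, hs⟩ : ∃ s, fourier α c s ≠ 0 := by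
      by_contra! h
      exact hc0 (eq_zero_of_fourier_eq_zero hn hα h)
    have hsk : s ∈ X k := by
      rcases hX.mem_or s with h | ⟨l, h⟩
      · exact absurd (hc2 s (Or.inl (Or.inl h))) hs
      · rcases hk l with rfl | rfl | rfl
        · exact absurd (hc2 s (Or.inl (Or.inr h))) hs
        · exact absurd (hc2 s (Or.inr h)) hs
        · exact h
    obtain ⟨w, hw⟩ := hX.exists_unit_shift (k - j)
    obtain ⟨c', hcc', hc'⟩ := exists_fourier_eq_fourier_mul hα w c
    refine ⟨c', fun t ht => ?_, fun h => hs ?_, hcc'.trans hcv⟩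
    · rw [hc']
      have := (hw i t).mpr ht
      rw [hjik] at this
      exact hc2 _ (Or.inr this)
    · have hsj : (w⁻¹ : (ZMod n)ˣ) * s ∈ X j := by
        rw [← hw, add_sub_cancel, Units.mul_inv_cancel_left]
        exact hsk
      have := h _ (Or.inr hsj)
      rwa [hc', Units.mul_inv_cancel_left] at this
  · exact ⟨c, hci, hc2, hcv⟩

end IsThreeSplitting

end Multipliers

/-! ### Assembly of the parameters -/

theorem exists_isRelativeDistance {n : ℕ} {C₁ C₂ : BinaryCode n} (h : C₂ < C₁) :
    ∃ d, IsRelativeDistance C₁ C₂ d := by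
  obtain ⟨c, hc, hc'⟩ := SetLike.exists_of_lt h
  have hne : {w | ∃ c, c ∈ C₁ ∧ c ∉ C₂ ∧ hammingNorm c = w}.Nonempty := ⟨_, c, hc, hc', rfl⟩
  exact ⟨sInf _, Nat.sInf_mem hne, fun _ hw => Nat.sInf_le hw⟩

end TriadicCode

open TriadicCode in
theorem mainTheorem4 (n : ℕ) (hn : Odd n)
    {F : Type*} [Field F] [Algebra (ZMod 2) F] (α : F) (hα : IsPrimitiveRoot α n)
    (Xinf : Set (ZMod n)) (X : Fin 3 → Set (ZMod n))
    (hX : TriadicCode.IsThreeSplitting n Xinf X) :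
    3 ∣ n + 2 * Xinf.ncard ∧
    (∃ C₁ C₂ : TriadicCode.BinaryCode n, TriadicCode.IsTriadicPair α Xinf X C₁ C₂) ∧
    ∀ C₁ C₂ : TriadicCode.BinaryCode n, TriadicCode.IsTriadicPair α Xinf X C₁ C₂ →
      C₂ ≤ C₁ ∧
      ∃ d : ℕ, TriadicCode.IsRelativeDistance C₁ C₂ d ∧
        TriadicCode.IsQuantumCode (TriadicCode.cssCode C₁ C₂) ((n + 2 * Xinf.ncard) / 3) d := by
  have hpos : 0 < n := hn.pos
  have : NeZero n := ⟨hpos.ne'⟩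
  have hcard := hX.card_eq
  have hdbl : ∀ i, ∀ t ∈ X i, t * 2 ∈ X i := fun i t => ((hX.coset i).mul_two_mem_iff hn).mpr
  have hdbl' : ∀ i j, ∀ t ∈ Xinf ∪ X i ∪ X j, t * 2 ∈ Xinf ∪ X i ∪ X j := fun i j t =>
    (hX.mul_two_mem_union_iff hn i j t).mpr
  refine ⟨by omega, ⟨zeroCode α (X 0), zeroCode α (Xinf ∪ X 0 ∪ X 1), 0, 1, by decide,
    hasDefiningSet_zeroCode hn hα (hdbl 0), hasDefiningSet_zeroCode hn hα (hdbl' 0 1)⟩, ?_⟩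
  rintro C₁ C₂ ⟨i, j, hij, h1, h2⟩
  obtain rfl := eq_zeroCode_of_hasDefiningSet hn hα h1
  obtain rfl := eq_zeroCode_of_hasDefiningSet hn hα h2
  have hle : zeroCode α (Xinf ∪ X i ∪ X j) ≤ zeroCode α (X i) :=
    zeroCode_anti fun t ht => Or.inl (Or.inr ht)
  have hfin1 := finrank_zeroCode hn hα (hdbl i)
  have hfin2 := finrank_zeroCode hn hα (hdbl' i j)
  rw [hX.ncard_union hij, hX.ncard_eq i 0, hX.ncard_eq j 0] at hfin2
  rw [hX.ncard_eq i 0] at hfin1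
  have hlt : zeroCode α (Xinf ∪ X i ∪ X j) < zeroCode α (X i) := by
    refine lt_of_le_of_ne hle fun h => ?_
    rw [h, hfin1] at hfin2
    omega
  obtain ⟨d, hd⟩ := exists_isRelativeDistance hlt
  -- The case of a one-dimensional code is void: (n + 2|Xinf|)/3 = |Xinf| + m is positive because n
  -- is.
  refine ⟨hle, d, hd, ⟨?_, fun _ => ?_, fun h => by omega⟩⟩
  · rw [finrank_cssCode hle, hfin1, hfin2]
    congr 1
    omega
  · refine isLeast_undetectable hle hd fun v hv hv' => ?_
    -- Of v ∉ C₁^⊥ only v ≠ 0 is needed.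
    obtain ⟨c, hc, hc', hw⟩ := hX.exists_hammingNorm_eq hn hα hij hv fun h0 =>
      hv' (h0 ▸ Submodule.zero_mem _)
    exact hw ▸ hd.2 ⟨c, hc, hc', rfl⟩
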